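/- Let $p\geq 3$ be a prime. A $\mathbb{Z}_p$-Lie lattice is a Lie algebra over the ring $\mathbb{Z}_p$ of $p$-adic integers whose underlying module is free of finite rank; its dimension is this rank. For $k\in\mathbb{N}$ (where $0 \in \mathbb{N}$), a $\mathbb{Z}_p$-Lie lattice $L$ is called self-similar of index $p^k$ if there exist a subalgebra $M\subseteq L$ of index $p^k$ and a homomorphism of Lie algebras $\varphi:M\to L$ such that the only ideal $I$ of $L$ with $I\subseteq M$ and $\varphi(I)\subseteq I$ is $I=\{0\}$. It is called strongly hereditarily self-similar of index $p^k$ if $L$ and all of its non-zero subalgebras are self-similar of index $p^k$. For an integer $d\geq 2$ and $a\in\mathbb{Z}_p$, let $L^d(a)$ be the $\mathbb{Z}_p$-Lie lattice with underlying module $\mathbb{Z}_p^d$, canonical basis $(x_0,\dots,x_{d-1})$, and bracket determined by $[x_i,x_j]=0$ and $[x_0,x_i]=a\,x_i$ for all $i,j\in\{1,\dots,d-1\}$. Theorem. Let $d\geq 2$ be an integer, and let $L$ be a solvable $\mathbb{Z}_p$-Lie lattice of dimension $d$ that is strongly hereditarily self-similar of index $p$. Then there is a unique $s\in\mathbb{N}\cup\{\infty\}$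 such that $L\simeq L^d(p^s)$ as $\mathbb{Z}_p$-Lie algebras, where $p^\infty:=0$. -/

import Mathlib

namespace ZpLieLattice

section SelfSimilarity

variable {p : ℕ} [Fact p.Prime] {L : Type*} [LieRing L] [LieAlgebra ℤ_[p] L]

/-- For a virtual endomorphism `φ : M → L` of `L` (a homomorphism of Lie algebras defined on a
subalgebra `M` of `L`), the ideal `I` of `L` is `φ`-invariant: it is contained in the domain `M`
and `φ(I) ⊆ I`. -/
def IsInvariant (M : LieSubalgebra ℤ_[p] L) (φ : M →ₗ⁅ℤ_[p]⁆ L) (I : LieIdeal ℤ_[p] L) : Prop :=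
  ∀ x ∈ I, ∃ hx : x ∈ M, φ ⟨x, hx⟩ ∈ I

/-- A virtual endomorphism `φ : M → L` is simple if no non-zero ideal of `L` is
`φ`-invariant. -/
def IsSimple (M : LieSubalgebra ℤ_[p] L) (φ : M →ₗ⁅ℤ_[p]⁆ L) : Prop :=
  ∀ I : LieIdeal ℤ_[p] L, IsInvariant M φ I → I = ⊥

variable (p L)

/-- `L` is self-similar of index `p ^ k`: there are a subalgebra `M` of `L` of index `p ^ k` and a
simple homomorphism of Lie algebras `φ : M → L`. -/
def IsSelfSimilar (k : ℕ) : Prop :=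
  ∃ M : LieSubalgebra ℤ_[p] L, M.toSubmodule.toAddSubgroup.index = p ^ k ∧
    ∃ φ : M →ₗ⁅ℤ_[p]⁆ L, IsSimple M φ

/-- `L` is strongly hereditarily self-similar of index `p ^ k`: `L` and all of its non-zero
subalgebras (each one regarded as a Lie algebra in its own right) are self-similar of index
`p ^ k`. -/
def IsStronglyHereditarilySelfSimilar (k : ℕ) : Prop :=
  IsSelfSimilar p L k ∧ ∀ M : LieSubalgebra ℤ_[p] L, M ≠ ⊥ → IsSelfSimilar p M k

end SelfSimilarity

/-- The `ℤ_p`-module underlying the Lie lattice `L^d(a)`, namely `ℤ_p ^ d`. -/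
def Std (p : ℕ) [Fact p.Prime] (d : ℕ) (_a : ℤ_[p]) : Type := Fin d → ℤ_[p]

namespace Std

variable {p : ℕ} [Fact p.Prime] {d : ℕ} {a : ℤ_[p]}

noncomputable instance : AddCommGroup (Std p d a) := inferInstanceAs (AddCommGroup (Fin d → ℤ_[p]))

noncomputable instance : Module ℤ_[p] (Std p d a) := inferInstanceAs (Module ℤ_[p] (Fin d → ℤ_[p]))

/-- The canonical basis `(x_0, …, x_{d-1})`. -/
noncomputable def basis (p : ℕ) [Fact p.Prime] (d : ℕ) (a : ℤ_[p]) :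
    Module.Basis (Fin d) ℤ_[p] (Std p d a) := Pi.basisFun ℤ_[p] (Fin d)

/-- The `0`-th coordinate. -/
noncomputable def coord [d.AtLeastTwo] : Std p d a →ₗ[ℤ_[p]] ℤ_[p] :=
  LinearMap.proj (R := ℤ_[p]) (φ := fun _ : Fin d => ℤ_[p]) 0

/-- The bracket `[x, y] = a (x₀ y - y₀ x)`: the alternating bilinear map with `[x_0, x_i] = a x_i`
and `[x_i, x_j] = 0` for `i, j ≠ 0` (see `lie_basis_zero` and `lie_basis` below). -/
noncomputable instance [d.AtLeastTwo] : Bracket (Std p d a) (Std p d a) :=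
  ⟨fun x y => a • (coord x • y - coord y • x)⟩

theorem lie_def [d.AtLeastTwo] (x y : Std p d a) :
    ⁅x, y⁆ = a • (coord x • y - coord y • x) := rfl

noncomputable instance [d.AtLeastTwo] : LieRing (Std p d a) where
  add_lie x y z := by simp only [lie_def, map_add]; module
  lie_add x y z := by simp only [lie_def, map_add]; module
  lie_self x := by simp only [lie_def, sub_self, smul_zero]
  leibniz_lie x y z := by
    simp only [lie_def, map_sub, map_smul, smul_eq_mul]; module

noncomputable instance [d.AtLeastTwo] : LieAlgebra ℤ_[p] (Std p d a) where
  lie_smul t x y := by simp only [lie_def, map_smul, smul_eq_mul]; module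

theorem coord_basis_zero [d.AtLeastTwo] : coord (basis p d a 0) = 1 := by
  change (Pi.basisFun ℤ_[p] (Fin d) 0 : Fin d → ℤ_[p]) 0 = 1
  simp

theorem coord_basis [d.AtLeastTwo] {i : Fin d} (hi : i ≠ 0) : coord (basis p d a i) = 0 := by
  change (Pi.basisFun ℤ_[p] (Fin d) i : Fin d → ℤ_[p]) 0 = 0
  simp [hi.symm]

theorem lie_basis_zero [d.AtLeastTwo] {i : Fin d} (hi : i ≠ 0) :
    ⁅basis p d a 0, basis p d a i⁆ = a • basis p d a i := by
  simp [lie_def, coord_basis_zero, coord_basis hi]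

theorem lie_basis [d.AtLeastTwo] {i j : Fin d} (hi : i ≠ 0) (hj : j ≠ 0) :
    ⁅basis p d a i, basis p d a j⁆ = 0 := by
  simp [lie_def, coord_basis hi, coord_basis hj]

end Std

/-- `p ^ s` in `ℤ_p` for `s ∈ ℕ ∪ {∞}`, with the convention `p ^ ∞ = 0`. -/
noncomputable def pPow (p : ℕ) [Fact p.Prime] : ℕ∞ → ℤ_[p]
  | none => 0
  | some n => (p : ℤ_[p]) ^ n

theorem pPow_top (p : ℕ) [Fact p.Prime] : pPow p ⊤ = 0 := rfl

theorem pPow_coe (p : ℕ) [Fact p.Prime] (n : ℕ) : pPow p (n : ℕ∞) = (p : ℤ_[p]) ^ n := rfl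

end ZpLieLattice

/-!
Let `φ : M → H` be a simple homomorphism on a subalgebra of index `p` of a Lie lattice `H`. Since
`p H ⊆ M`, the formula `ψ y = φ (p y)` defines an endomorphism of the module `H`; it satisfies
`[ψ a, ψ b] = p ψ [a, b]`, is injective, has rank at most one modulo `p`, and maps no non-zero ideal
`N` into `p N` (`IsSelfSimilar.exists_end`). All of the argument is in terms of `ψ`.

Two kinds of lattices have no such `ψ`: Heisenberg lattices (`not_isSelfSimilar_of_heisenberg`), and
the lattices spanned by `p x`, `v` and `p Dⁱ v` for `i ≥ 0`, where `D = ad x` acts non-nilpotently on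
an abelian ideal that contains `v`, and `D v` is not a multiple of `v`
(`not_isSelfSimilar_of_cyclic`). In the second case `ψ` normalizes the action of `D` up to a factor
`c`, and comparing the coefficients of `det (1 - X D)` shows that `c` is a root of unity
(`exists_pow_eq_pow_of_intertwine`).

Consequently, in a strongly hereditarily self-similar `L` every element of an abelian ideal is an
eigenvector of every `ad x` (`exists_lie_eq_smul`), so `ad x` acts on an abelian ideal by a scalar
`f x`. If `L` is solvable, a maximal abelian ideal is its own centralizer, again because there are no
Heisenberg subalgebras (`exists_selfCentralizing_abelian_ideal`); it is then the kernel of `f`, and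
`[x, y] = f x • y - f y • x` on all of `L`. Writing `f` as `p ^ s` times a surjective form gives the
isomorphism with `L^d(p^s)`, and `s` is unique because `p ^ n` divides all brackets of `L^d(p^s)`
exactly when `n ≤ s`.
-/

/-! ### Injective endomorphisms of free modules -/

theorem det_ne_zero_of_injective {R M : Type*} [CommRing R] [IsDomain R] [AddCommGroup M]
    [Module R M] [Module.Free R M] [Module.Finite R M] {ψ : Module.End R M}
    (hψ : Function.Injective ψ) : LinearMap.det ψ ≠ 0 := by
  intro h0
  obtain ⟨v, hv, hv0⟩ := (Submodule.ne_bot_iff _).1 (LinearMap.bot_lt_ker_of_det_eq_zero h0).ne'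
  exact hv0 (hψ (by simpa using hv))

open Polynomial in
/-- If `ψ` is injective and conjugates `a • E` into `b • E`, the coefficients `qₖ` of
`det (1 - X E)` satisfy `aᵏ qₖ = bᵏ qₖ`; some `qₖ` with `k ≥ 1` is non-zero unless `E` is nilpotent. -/
theorem exists_pow_eq_pow_of_intertwine {R M : Type*} [CommRing R] [IsDomain R] [Infinite R]
    [AddCommGroup M] [Module R M] [Module.Free R M] [Module.Finite R M] [IsNoetherian R M]
    {E ψ : Module.End R M} {a b : R} (hψ : Function.Injective ψ)
    (h : ∀ m, a • E (ψ m) = b • ψ (E m)) (hE : ∃ m, ∀ n, (E ^ n) m ≠ 0) :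
    ∃ k, k ≠ 0 ∧ a ^ k = b ^ k := by
  classical
  let B := Module.Free.chooseBasis R M
  set Q := (LinearMap.toMatrix B B E).charpolyRev with hQ
  have heval (t : R) : Q.eval t = LinearMap.det (1 - t • E) := by
    rw [hQ, Matrix.charpolyRev, ← coe_evalRingHom, RingHom.map_det, ← LinearMap.det_toMatrix B]
    have hB : LinearMap.toMatrix B B (1 - t • E) = 1 - t • LinearMap.toMatrix B B E := by
      rw [map_sub, map_smul, LinearMap.toMatrix_one]
    rw [hB]
    congr 1
    ext i j
    generalize LinearMap.toMatrix B B E = T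
    rcases eq_or_ne i j with rfl | hij
    · simp [mul_comm t]
    · simp [hij, mul_comm t]
  have hdet := det_ne_zero_of_injective hψ
  have hcomp : Q.comp (C a * X) = Q.comp (C b * X) := by
    refine Polynomial.funext fun t => ?_
    simp only [eval_comp, eval_mul, eval_C, eval_X, heval]
    refine mul_right_cancel₀ hdet ?_
    rw [← map_mul, mul_comm _ (LinearMap.det ψ), ← map_mul]
    congr 1
    ext m
    simp [mul_comm _ t, mul_smul, h]
  by_contra! hk
  obtain ⟨m, hm⟩ := hE
  have hcoeff (k : ℕ) (hk0 : k ≠ 0) : Q.coeff k = 0 := by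
    have := congrArg (coeff · k) hcomp
    simp only [comp_C_mul_X_coeff] at this
    by_contra hne
    exact hk k hk0 (mul_left_cancel₀ hne this)
  have hchar : E.charpoly = X ^ Module.finrank R M := by
    have hEB : E.charpoly = (LinearMap.toMatrix B B E).charpoly :=
      (LinearMap.charpoly_toMatrix E B).symm
    have hdeg := LinearMap.charpoly_natDegree E
    ext j
    rw [coeff_X_pow]
    split_ifs with hj
    · rw [hj, ← hdeg]; exact E.charpoly_monic
    rcases lt_or_gt_of_ne hj with hj | hj
    · have := hcoeff (Module.finrank R M - j) (by omega)
      rw [hQ, ← Matrix.reverse_charpoly, ← hEB, coeff_reverse, hdeg, revAt_le (by omega)] at this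
      rwa [Nat.sub_sub_self hj.le] at this
    · exact coeff_eq_zero_of_natDegree_lt (by omega)
  obtain ⟨n, hn⟩ := (LinearMap.charpoly_eq_X_pow_iff E).1 hchar m
  exact hm n hn

/-- By the Cayley-Hamilton theorem, `det ψ` annihilates the cokernel of `ψ`. -/
theorem exists_smul_eq_apply_of_injective {R M : Type*} [CommRing R] [IsDomain R]
    [AddCommGroup M] [Module R M] [Module.Free R M] [Module.Finite R M]
    {ψ : Module.End R M} (hψ : Function.Injective ψ) (y : M) :
    ∃ t : R, t ≠ 0 ∧ ∃ z, ψ z = t • y := by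
  have hdet := det_ne_zero_of_injective hψ
  rw [LinearMap.det_eq_sign_charpoly_coeff] at hdet
  refine ⟨ψ.charpoly.coeff 0, right_ne_zero_of_mul hdet,
    -(Polynomial.aeval ψ ψ.charpoly.divX) y, ?_⟩
  have h := LinearMap.congr_fun ψ.aeval_self_charpoly y
  rw [← Polynomial.X_mul_divX_add ψ.charpoly] at h
  simp only [map_add, map_mul, Polynomial.aeval_X, Polynomial.aeval_C, LinearMap.add_apply,
    Module.End.mul_apply, Module.algebraMap_end_apply, LinearMap.zero_apply] at h
  rw [map_neg, neg_eq_of_add_eq_zero_right h]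

namespace ZpLieLattice

variable {p : ℕ} [Fact p.Prime]

/-! ### Self-similarity of index `p` as an endomorphism -/

/-- A self-similarity `φ : M → H` of index `p` of a torsion-free Lie lattice, encoded by the
injective map `ψ y = φ (p y)`, which is defined on all of `H` because `p H ⊆ M`. The third property
says that `ψ` has rank at most one modulo `p`; it holds since `ψ M = p φ M` and `H / M` has
order `p`. The kernel of `ψ` is a `φ`-invariant ideal, so simplicity makes `ψ` injective. -/
theorem IsSelfSimilar.exists_end {H : Type*} [LieRing H] [LieAlgebra ℤ_[p] H]
    [Module.IsTorsionFree ℤ_[p] H] (h : IsSelfSimilar p H 1) :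
    ∃ ψ : H →ₗ[ℤ_[p]] H, Function.Injective ψ ∧
      (∀ a b, ⁅ψ a, ψ b⁆ = (p : ℤ_[p]) • ψ ⁅a, b⁆) ∧
      (∀ y₁ y₂, (∃ z, ψ y₂ = (p : ℤ_[p]) • z) ∨
        ∃ (s : ℤ_[p]) (z : H), ψ (y₁ + s • y₂) = (p : ℤ_[p]) • z) ∧
      ∀ N : LieIdeal ℤ_[p] H, (∀ y ∈ N, ∃ z ∈ N, ψ y = (p : ℤ_[p]) • z) → N = ⊥ := by
  obtain ⟨M, hM, φ, hφ⟩ := h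
  have hp0 : (p : ℤ_[p]) ≠ 0 := by exact_mod_cast (Fact.out : p.Prime).ne_zero
  rw [pow_one] at hM
  have hpM (y : H) : (p : ℤ_[p]) • y ∈ M := by
    have := AddSubgroup.nsmul_index_mem M.toSubmodule.toAddSubgroup y
    rw [hM] at this
    rw [Nat.cast_smul_eq_nsmul]
    exact this
  let ψ : H →ₗ[ℤ_[p]] H :=
    (φ : M →ₗ[ℤ_[p]] H) ∘ₗ ((p : ℤ_[p]) • LinearMap.id).codRestrict M.toSubmodule hpM
  have hψ (y : H) : ψ y = φ ⟨(p : ℤ_[p]) • y, hpM y⟩ := rfl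
  have hψM (y : H) (hy : y ∈ M) : ψ y = (p : ℤ_[p]) • φ ⟨y, hy⟩ := by
    rw [hψ, ← map_smul]; rfl
  have hbr (a b : H) : ⁅ψ a, ψ b⁆ = (p : ℤ_[p]) • ψ ⁅a, b⁆ := by
    rw [hψ, hψ, ← LieHom.map_lie, ← map_smul, hψ]
    congr 1
    ext
    simp
  have hN (N : LieIdeal ℤ_[p] H) (hN : ∀ y ∈ N, ∃ z ∈ N, ψ y = (p : ℤ_[p]) • z) : N = ⊥ := by
    let I : LieIdeal ℤ_[p] H :=
      { (N : Submodule ℤ_[p] H).map ((p : ℤ_[p]) • LinearMap.id) with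
        lie_mem := by
          rintro x _ ⟨y, hy, rfl⟩
          exact ⟨⁅x, y⁆, N.lie_mem hy, by simp⟩ }
    have hI : I = ⊥ := by
      refine hφ I ?_
      rintro _ ⟨y, hy, rfl⟩
      refine ⟨hpM y, ?_⟩
      obtain ⟨z, hz, hyz⟩ := hN y hy
      exact ⟨z, hz, hyz.symm⟩
    rw [LieSubmodule.eq_bot_iff] at hI ⊢
    intro y hy
    have := hI ((p : ℤ_[p]) • y) ⟨y, hy, rfl⟩
    exact (smul_eq_zero_iff_right hp0).1 this
  refine ⟨ψ, ?_, hbr, ?_, hN⟩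
  · let K : LieIdeal ℤ_[p] H :=
      { LinearMap.ker ψ with
        lie_mem := by
          intro x y hy
          have hy : ψ y = 0 := hy
          have := hbr x y
          rw [hy, lie_zero] at this
          exact (smul_eq_zero_iff_right hp0).1 this.symm }
    have hK : K = ⊥ := hN K fun y hy => ⟨0, K.zero_mem, by
      rw [smul_zero]; exact hy⟩
    rw [← LinearMap.ker_eq_bot, Submodule.eq_bot_iff]
    exact fun y hy => (LieSubmodule.eq_bot_iff K).1 hK y hy
  · intro y₁ y₂
    by_cases hy₂ : y₂ ∈ M
    · exact Or.inl ⟨_, hψM _ hy₂⟩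
    · right
      have hcard : Nat.card (H ⧸ M.toSubmodule.toAddSubgroup) = p := hM
      have hne : (QuotientAddGroup.mk y₂ : H ⧸ M.toSubmodule.toAddSubgroup) ≠ 0 := by
        rwa [Ne, QuotientAddGroup.eq_zero_iff]
      obtain ⟨n, hn⟩ := AddSubgroup.mem_zmultiples_iff.1
        (mem_zmultiples_of_prime_card
          (g' := (QuotientAddGroup.mk y₁ : H ⧸ M.toSubmodule.toAddSubgroup)) hcard hne)
      have hmem : y₁ + (-n : ℤ_[p]) • y₂ ∈ M := by
        rw [← QuotientAddGroup.mk_zsmul, QuotientAddGroup.eq] at hn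
        have h' : -(n • y₂) + y₁ ∈ M := hn
        rwa [neg_smul, Int.cast_smul_eq_zsmul, add_comm]
      exact ⟨_, _, hψM _ hmem⟩

/-! ### Lattices that are not self-similar of index `p` -/

section Heisenberg

variable {H : Type*} [LieRing H] [LieAlgebra ℤ_[p] H] [Module.IsTorsionFree ℤ_[p] H]

/-- A Heisenberg lattice is not self-similar of index `p`: simplicity forces `ψ` to be non-zero
modulo `p` on the centre, so by the rank condition `ψ` vanishes modulo `p` on the quotient by the
centre, whence its determinant there, which is `p` times the scalar by which `ψ` acts on the
centre, is divisible by `p ^ 2`. -/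
theorem not_isSelfSimilar_of_heisenberg {x y z : H} (hxy : ⁅x, y⁆ = z) (hxz : ⁅x, z⁆ = 0)
    (hyz : ⁅y, z⁆ = 0) (hz : z ≠ 0) (htop : ∀ h : H, ∃ a b c : ℤ_[p], h = a • x + b • y + c • z) :
    ¬ IsSelfSimilar p H 1 := by
  intro hself
  obtain ⟨ψ, -, hbr, hrank, hsimple⟩ := hself.exists_end
  have hp0 : (p : ℤ_[p]) ≠ 0 := by exact_mod_cast (Fact.out : p.Prime).ne_zero
  have hyx : ⁅y, x⁆ = -z := by rw [← hxy, lie_skew]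
  have hzx : ⁅z, x⁆ = 0 := by rw [← lie_skew, hxz, neg_zero]
  have hzy : ⁅z, y⁆ = 0 := by rw [← lie_skew, hyz, neg_zero]
  have hcoord {a b c a' b' c' : ℤ_[p]}
      (h : a • x + b • y + c • z = a' • x + b' • y + c' • z) : a = a' ∧ b = b' ∧ c = c' := by
    have h1 := congrArg (⁅·, y⁆) h
    have h2 := congrArg (⁅x, ·⁆) h
    simp only [add_lie, lie_add, smul_lie, lie_smul, hxy, hxz, hzy, lie_self, smul_zero, zero_add,
      add_zero] at h1 h2
    have ha := smul_left_injective ℤ_[p] hz h1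
    have hb := smul_left_injective ℤ_[p] hz h2
    subst ha hb
    exact ⟨rfl, rfl, smul_left_injective ℤ_[p] hz (add_left_cancel h)⟩
  obtain ⟨a₁, b₁, c₁, hx'⟩ := htop (ψ x)
  obtain ⟨a₂, b₂, c₂, hy'⟩ := htop (ψ y)
  obtain ⟨a, b, ζ, hz'⟩ := htop (ψ z)
  have hdet := hbr x y
  rw [hxy, hx', hy', hz'] at hdet
  simp only [add_lie, lie_add, smul_lie, lie_smul, hxy, hyx, hxz, hyz, hzx, hzy, lie_self,
    smul_zero, add_zero, zero_add] at hdet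
  obtain ⟨ha, hb, hζ⟩ := hcoord (a := p * a) (b := p * b) (c := p * ζ) (a' := 0) (b' := 0)
    (c' := a₁ * b₂ - a₂ * b₁) (by
      have : (p * a : ℤ_[p]) • x + (p * b : ℤ_[p]) • y + (p * ζ : ℤ_[p]) • z
        = (p : ℤ_[p]) • (a • x + b • y + ζ • z) := by module
      rw [this, ← hdet]
      module)
  have ha : a = 0 := by simpa [hp0] using ha
  have hb : b = 0 := by simpa [hp0] using hb
  subst ha hb
  have hnd : ¬ (p : ℤ_[p]) ∣ ζ := by
    rintro ⟨ξ, rfl⟩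
    let N : LieIdeal ℤ_[p] H :=
      { Submodule.span ℤ_[p] {z} with
        lie_mem := by
          intro h w hw
          obtain ⟨r, rfl⟩ := Submodule.mem_span_singleton.1 hw
          obtain ⟨a, b, c, rfl⟩ := htop h
          have : ⁅a • x + b • y + c • z, r • z⁆ = 0 := by simp [hxz, hyz]
          rw [this]
          exact Submodule.zero_mem _ }
    have hN : N = ⊥ := by
      refine hsimple N fun w hw => ?_
      obtain ⟨r, rfl⟩ := Submodule.mem_span_singleton.1 hw
      refine ⟨(r * ξ) • z, Submodule.mem_span_singleton.2 ⟨_, rfl⟩, ?_⟩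
      rw [map_smul, hz']
      module
    exact hz ((LieSubmodule.eq_bot_iff N).1 hN z (Submodule.mem_span_singleton_self z))
  have hdvd {w : H} {a b c : ℤ_[p]} (hw : ψ w = a • x + b • y + c • z) :
      (p : ℤ_[p]) ∣ a ∧ (p : ℤ_[p]) ∣ b := by
    rcases hrank w z with ⟨h, hh⟩ | ⟨s, h, hh⟩
    · obtain ⟨a', b', c', rfl⟩ := htop h
      rw [hz'] at hh
      obtain ⟨-, -, h3⟩ := hcoord (a' := p * a') (b' := p * b') (c' := p * c')
        (hh.trans (by module))
      exact absurd ⟨_, h3⟩ hnd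
    · obtain ⟨a', b', c', rfl⟩ := htop h
      rw [map_add, map_smul, hw, hz'] at hh
      obtain ⟨h1, h2, -⟩ := hcoord (a := a) (b := b) (c := c + s * ζ) (a' := p * a')
        (b' := p * b') (c' := p * c') (Eq.trans (by module) (hh.trans (by module)))
      exact ⟨⟨_, h1⟩, ⟨_, h2⟩⟩
  obtain ⟨⟨a₁, rfl⟩, ⟨b₁, rfl⟩⟩ := hdvd hx'
  obtain ⟨⟨a₂, rfl⟩, ⟨b₂, rfl⟩⟩ := hdvd hy'
  refine hnd ⟨a₁ * b₂ - a₂ * b₁, mul_left_cancel₀ hp0 ?_⟩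
  rw [hζ]
  ring

end Heisenberg

section Cyclic

variable {H : Type*} [LieRing H] [LieAlgebra ℤ_[p] H] [Module.IsTorsionFree ℤ_[p] H]
  [Module.Finite ℤ_[p] H]

/-- Nakayama's lemma over `ℤ_p`. -/
theorem le_of_forall_mem_add_smul {M : Type*} [AddCommGroup M] [Module ℤ_[p] M]
    [IsNoetherian ℤ_[p] M] {N P : Submodule ℤ_[p] M}
    (h : ∀ w ∈ P, ∃ n ∈ N, ∃ w' ∈ P, w = n + (p : ℤ_[p]) • w') : P ≤ N := by
  refine Submodule.le_of_le_smul_of_le_jacobson_bot (I := Ideal.span {(p : ℤ_[p])})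
    (IsNoetherian.noetherian P) ?_ ?_
  · rw [← PadicInt.maximalIdeal_eq_span_p]
    exact IsLocalRing.maximalIdeal_le_jacobson _
  · intro w hw
    obtain ⟨n, hn, w', hw', rfl⟩ := h w hw
    exact Submodule.add_mem_sup hn
      (Submodule.smul_mem_smul (Ideal.mem_span_singleton_self _) hw')

/-- Think of `u i = p Dⁱ v` and `X = p x`, where `D = ad x` acts non-nilpotently on an abelian
ideal containing `v`, and `D v` is not a multiple of `v`. Then the lattice spanned by `X`, `v` and
the `u i` is not self-similar of index `p`. The map `ψ` multiplies `X` by `p` times a unit `c`,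
modulo the abelian ideal; so it is determined there by `ψ v = f v + w`, where `w` lies in the span
`P` of the `u i`, and `ψ (u i)` is congruent to `cⁱ f (u i)` modulo `p P`. If `p` divides `f`, then
`P` contradicts simplicity; if `f` is a unit, then `ψ v` and `ψ (u 1)` are
linearly independent modulo `p`. -/
theorem not_isSelfSimilar_of_cyclic {X v : H} {u : ℕ → H} {P Λ : Submodule ℤ_[p] H}
    (hP : P = Submodule.span ℤ_[p] (Set.range u)) (hΛ : Λ = Submodule.span ℤ_[p] {v} ⊔ P)
    (hu0 : u 0 = (p : ℤ_[p]) • v) (hXv : ⁅X, v⁆ = u 1)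
    (hXu : ∀ i, ⁅X, u i⁆ = (p : ℤ_[p]) • u (i + 1))
    (hab : ∀ a ∈ Λ, ∀ b ∈ Λ, ⁅a, b⁆ = 0)
    (htop : ∀ h : H, ∃ a : ℤ_[p], ∃ l ∈ Λ, h = a • X + l)
    (hu : ∀ i, u i ≠ 0) (hu1 : ∀ r : ℤ_[p], u 1 ≠ r • u 0) : ¬ IsSelfSimilar p H 1 := by
  intro hself
  obtain ⟨ψ, hinj, hbr, hrank, hsimple⟩ := hself.exists_end
  have hp0 : (p : ℤ_[p]) ≠ 0 := by exact_mod_cast (Fact.out : p.Prime).ne_zero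
  have hpprime : Prime (p : ℤ_[p]) := PadicInt.prime_p
  have hPΛ : P ≤ Λ := hΛ ▸ le_sup_right
  have hvΛ : v ∈ Λ := hΛ ▸ Submodule.mem_sup_left (Submodule.mem_span_singleton_self v)
  have huP (i : ℕ) : u i ∈ P := hP ▸ Submodule.subset_span ⟨i, rfl⟩
  have hΛmem {l : H} (hl : l ∈ Λ) : ∃ b : ℤ_[p], ∃ w ∈ P, l = b • v + w := by
    rw [hΛ] at hl
    obtain ⟨y, hy, w, hw, rfl⟩ := Submodule.mem_sup.1 hl
    obtain ⟨b, rfl⟩ := Submodule.mem_span_singleton.1 hy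
    exact ⟨b, w, hw, rfl⟩
  have hEP {w : H} (hw : w ∈ P) : ∃ w' ∈ P, ⁅X, w⁆ = (p : ℤ_[p]) • w' := by
    rw [hP] at hw
    induction hw using Submodule.span_induction with
    | mem w hw => obtain ⟨i, rfl⟩ := hw; exact ⟨u (i + 1), huP _, hXu i⟩
    | zero => exact ⟨0, P.zero_mem, by simp⟩
    | add a b _ _ ha hb =>
      obtain ⟨a', ha', ha⟩ := ha
      obtain ⟨b', hb', hb⟩ := hb
      exact ⟨a' + b', P.add_mem ha' hb', by rw [lie_add, ha, hb, smul_add]⟩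
    | smul t a _ ha =>
      obtain ⟨a', ha', ha⟩ := ha
      exact ⟨t • a', P.smul_mem t ha', by rw [lie_smul, ha, smul_comm]⟩
  have hEΛ {l : H} (hl : l ∈ Λ) : ⁅X, l⁆ ∈ P := by
    obtain ⟨b, w, hw, rfl⟩ := hΛmem hl
    obtain ⟨w', hw', h⟩ := hEP hw
    rw [lie_add, lie_smul, hXv, h]
    exact P.add_mem (P.smul_mem _ (huP 1)) (P.smul_mem _ hw')
  have hideal (h : H) {l : H} (hl : l ∈ Λ) : ⁅h, l⁆ ∈ P := by
    obtain ⟨a, m, hm, rfl⟩ := htop h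
    rw [add_lie, smul_lie, hab m hm l hl, add_zero]
    exact P.smul_mem _ (hEΛ hl)
  have hX {a : ℤ_[p]} (h : a • X ∈ Λ) : a = 0 := by
    have := hab _ h v hvΛ
    rw [smul_lie, hXv] at this
    exact (smul_eq_zero.1 this).resolve_right (hu 1)
  -- For `l ∈ Λ` one has `(ad l) ^ 2 = 0`, hence `(ad (ψ l)) ^ 2 = 0` because the cokernel of `ψ`
  -- is torsion; as `ad X` is not nilpotent, `ψ l` has no component along `X`.
  have hψΛ {l : H} (hl : l ∈ Λ) : ψ l ∈ Λ := by
    obtain ⟨r, m, hm, hr⟩ := htop (ψ l)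
    obtain ⟨t, ht, y, hy⟩ := exists_smul_eq_apply_of_injective hinj v
    have h1 : ⁅ψ l, ⁅ψ l, ψ y⁆⁆ = 0 := by
      have h0 : ⁅l, ⁅l, y⁆⁆ = 0 := by
        refine hab l hl _ ?_
        rw [← lie_skew]
        exact Λ.neg_mem (hPΛ (hideal y hl))
      rw [hbr, lie_smul, hbr, h0, map_zero, smul_zero, smul_zero]
    have h2 : ⁅ψ l, v⁆ = r • u 1 := by
      rw [hr, add_lie, smul_lie, hXv, hab m hm v hvΛ, add_zero]
    have h3 : ⁅ψ l, u 1⁆ = r • (p : ℤ_[p]) • u 2 := by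
      rw [hr, add_lie, smul_lie, hXu, hab m hm _ (hPΛ (huP 1)), add_zero]
    rw [hy, lie_smul, h2, lie_smul, lie_smul, h3] at h1
    have hr0 : r = 0 := by simpa [ht, hp0, hu 2] using h1
    rw [hr, hr0, zero_smul, zero_add]
    exact hm
  obtain ⟨c', m₀, hm₀, hψX⟩ := htop (ψ X)
  have hc' {l : H} (hl : l ∈ Λ) : c' • ⁅X, ψ l⁆ = (p : ℤ_[p]) • ψ ⁅X, l⁆ := by
    rw [← hbr, hψX, add_lie, smul_lie, hab m₀ hm₀ _ (hψΛ hl), add_zero]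
  obtain ⟨c, hc, hψE⟩ : ∃ c : ℤ_[p], IsUnit c ∧ ∀ l ∈ Λ, ψ ⁅X, l⁆ = c • ⁅X, ψ l⁆ := by
    let E : Module.End ℤ_[p] Λ := (LieAlgebra.ad ℤ_[p] H X).restrict
      (fun l hl => hPΛ (hEΛ hl))
    have hE (n : ℕ) : ((E ^ (n + 1)) ⟨v, hvΛ⟩ : H) = (p : ℤ_[p]) ^ n • u (n + 1) := by
      induction n with
      | zero => simpa [E] using hXv
      | succ n ih =>
        rw [pow_succ', Module.End.mul_apply, LinearMap.coe_restrict_apply, ih]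
        simp [hXu, pow_succ, mul_smul]
    obtain ⟨k, hk, hkk⟩ := exists_pow_eq_pow_of_intertwine (E := E)
      (ψ := ψ.restrict fun l hl => hψΛ hl) (a := c') (b := p)
      (fun a b h => Subtype.ext (hinj (congrArg Subtype.val h)))
      (fun m => Subtype.ext (hc' m.2))
      ⟨⟨v, hvΛ⟩, fun n h => by
        have h1 : (E ^ (n + 1)) ⟨v, hvΛ⟩ = 0 := by
          rw [pow_succ', Module.End.mul_apply, h, map_zero]
        have h2 := hE n
        rw [h1] at h2
        exact smul_ne_zero (pow_ne_zero n hp0) (hu _) h2.symm⟩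
    obtain ⟨c, rfl⟩ : (p : ℤ_[p]) ∣ c' := hpprime.dvd_of_dvd_pow (hkk.symm ▸ dvd_pow_self _ hk)
    refine ⟨c, IsUnit.of_pow_eq_one (n := k) ?_ hk, fun l hl => ?_⟩
    · rw [mul_pow] at hkk
      exact mul_left_cancel₀ (pow_ne_zero k hp0) (hkk.trans (mul_one _).symm)
    · refine smul_right_injective H hp0 ?_
      change (p : ℤ_[p]) • _ = (p : ℤ_[p]) • _
      rw [← hc' hl, mul_smul]
  obtain ⟨f, w₀, hw₀, hψv⟩ := hΛmem (hψΛ hvΛ)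
  have hψu (i : ℕ) : ∃ w ∈ P, ψ (u i) = c ^ i • (f • u i + (p : ℤ_[p]) • w) := by
    obtain ⟨w', hw', hw⟩ := hEP hw₀
    induction i with
    | zero => exact ⟨w₀, hw₀, by rw [hu0, map_smul, hψv]; module⟩
    | succ i ih =>
      rcases Nat.eq_zero_or_pos i with rfl | -
      · refine ⟨w', hw', ?_⟩
        rw [zero_add, ← hXv, hψE v hvΛ, hψv, lie_add, lie_smul, hw, hXv]
        module
      · obtain ⟨w₁, hw₁, h₁⟩ := ih
        obtain ⟨w₂, hw₂, h₂⟩ := hEP hw₁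
        refine ⟨w₂, hw₂, smul_right_injective H hp0 ?_⟩
        change (p : ℤ_[p]) • _ = (p : ℤ_[p]) • _
        rw [← map_smul, ← hXu, hψE _ (hPΛ (huP i)), h₁, lie_smul, lie_add, lie_smul, lie_smul, hXu,
          h₂]
        module
  have hu1P : u 1 ∈ P := huP 1
  by_cases hf : (p : ℤ_[p]) ∣ f
  · obtain ⟨f, rfl⟩ := hf
    let N : LieIdeal ℤ_[p] H := { P with lie_mem := fun {h l} hl => hideal h (hPΛ hl) }
    have hN : N = ⊥ := by
      refine hsimple N fun y hy => ?_
      change y ∈ P at hy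
      change ∃ z ∈ P, _
      rw [hP] at hy
      induction hy using Submodule.span_induction with
      | mem w hw =>
        obtain ⟨i, rfl⟩ := hw
        obtain ⟨w, hw, h⟩ := hψu i
        refine ⟨c ^ i • (f • u i + w), P.smul_mem _ (P.add_mem (P.smul_mem _ (huP i)) hw), ?_⟩
        rw [h]
        module
      | zero => exact ⟨0, P.zero_mem, by simp⟩
      | add a b _ _ ha hb =>
        obtain ⟨a', ha', ha⟩ := ha
        obtain ⟨b', hb', hb⟩ := hb
        exact ⟨a' + b', P.add_mem ha' hb', by rw [map_add, ha, hb, smul_add]⟩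
      | smul t a _ ha =>
        obtain ⟨a', ha', ha⟩ := ha
        exact ⟨t • a', P.smul_mem t ha', by rw [map_smul, ha, smul_comm]⟩
    exact hu 1 ((LieSubmodule.eq_bot_iff N).1 hN _ hu1P)
  have hunit {t : ℤ_[p]} (ht : ¬ (p : ℤ_[p]) ∣ t) : IsUnit t := by
    rw [PadicInt.isUnit_iff]
    by_contra hne
    exact ht (PadicInt.norm_lt_one_iff_dvd t |>.1 (lt_of_le_of_ne t.norm_le_one hne))
  -- If `u 1` were in `ℤ_p u 0 + p P`, then so would be all `u i`, and `P = ℤ_p u 0` by Nakayama's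
  -- lemma.
  have hkey {r : ℤ_[p]} {w : H} (hw : w ∈ P) : u 1 ≠ r • u 0 + (p : ℤ_[p]) • w := by
    intro h
    have hui (i : ℕ) : ∃ r : ℤ_[p], ∃ w ∈ P, u i = r • u 0 + (p : ℤ_[p]) • w := by
      induction i with
      | zero => exact ⟨1, 0, P.zero_mem, by simp⟩
      | succ i ih =>
        obtain ⟨r', w', hw', h'⟩ := ih
        obtain ⟨w'', hw'', h''⟩ := hEP hw'
        refine ⟨r' * r, r' • w + w'', P.add_mem (P.smul_mem _ hw) hw'',
          smul_right_injective H hp0 ?_⟩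
        change (p : ℤ_[p]) • _ = (p : ℤ_[p]) • _
        rw [← hXu, h', lie_add, lie_smul, lie_smul, h'', hXu, zero_add, h]
        module
    have hle : P ≤ Submodule.span ℤ_[p] {u 0} := by
      refine le_of_forall_mem_add_smul fun w hw => ?_
      have : P ≤ Submodule.span ℤ_[p] {u 0} ⊔ P.map ((p : ℤ_[p]) • LinearMap.id) := by
        conv_lhs => rw [hP]
        rw [Submodule.span_le]
        rintro _ ⟨i, rfl⟩
        obtain ⟨r, w, hw, h⟩ := hui i
        rw [h]
        exact Submodule.add_mem_sup (Submodule.mem_span_singleton.2 ⟨r, rfl⟩) ⟨w, hw, rfl⟩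
      obtain ⟨n, hn, _, ⟨w', hw', rfl⟩, h⟩ := Submodule.mem_sup.1 (this hw)
      exact ⟨n, hn, w', hw', h.symm⟩
    obtain ⟨r, hr⟩ := Submodule.mem_span_singleton.1 (hle hu1P)
    exact hu1 r hr.symm
  have hv {r : ℤ_[p]} (hr : r • v ∈ P) : (p : ℤ_[p]) ∣ r := by
    by_contra hnd
    have hvP : v ∈ P := (Submodule.smul_mem_iff_of_isUnit P (hunit hnd)).1 hr
    obtain ⟨w, hw, h⟩ := hEP hvP
    exact hkey hw (r := 0) (by rw [← hXv, h, zero_smul, zero_add])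
  -- Comparing components in `p H`, which meets `Λ` in `p Λ`.
  have hdvd {l h : H} (hl : l ∈ Λ) (hlh : l = (p : ℤ_[p]) • h) :
      ∃ b : ℤ_[p], ∃ w ∈ P, l = (p : ℤ_[p]) • (b • v + w) := by
    obtain ⟨a, m, hm, rfl⟩ := htop h
    have ha : (p : ℤ_[p]) * a = 0 := hX (by
      have : ((p : ℤ_[p]) * a) • X = l - (p : ℤ_[p]) • m := by rw [hlh]; module
      rw [this]
      exact Λ.sub_mem hl (Λ.smul_mem _ hm))
    have ha : a = 0 := by simpa [hp0] using ha
    obtain ⟨b, w, hw, rfl⟩ := hΛmem hm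
    exact ⟨b, w, hw, by rw [hlh, ha, zero_smul, zero_add]⟩
  obtain ⟨w₁, hw₁, hψu1⟩ := hψu 1
  rw [pow_one] at hψu1
  obtain ⟨e, he⟩ : IsUnit (c * f) := hc.mul (hunit hf)
  rcases hrank v (u 1) with ⟨z, hz⟩ | ⟨s, z, hz⟩
  · obtain ⟨b, w, hw, h⟩ := hdvd (hψΛ (hPΛ hu1P)) hz
    refine hkey (r := (↑e⁻¹ : ℤ_[p]) * b) (w := (↑e⁻¹ : ℤ_[p]) • (w - c • w₁))
      (P.smul_mem _ (P.sub_mem hw (P.smul_mem _ hw₁))) ?_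
    have h1 : (e : ℤ_[p]) • u 1 = b • u 0 + (p : ℤ_[p]) • (w - c • w₁) := by
      rw [hψu1] at h
      rw [he, hu0]
      linear_combination (norm := module) h
    have h2 : u 1 = (↑e⁻¹ : ℤ_[p]) • (e : ℤ_[p]) • u 1 := by
      rw [smul_smul, Units.inv_mul, one_smul]
    rw [h2, h1]
    module
  · obtain ⟨b, w, hw, h⟩ := hdvd (hψΛ (Λ.add_mem hvΛ (Λ.smul_mem _ (hPΛ hu1P)))) hz
    refine hf ?_
    have : (f - p * b) • v ∈ P := by
      have h' : (f - p * b) • v = (p : ℤ_[p]) • w - w₀ - s • (c • (f • u 1 + (p : ℤ_[p]) • w₁)) := by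
        rw [map_add, map_smul, hψv, hψu1] at h
        linear_combination (norm := module) h
      rw [h']
      exact P.sub_mem (P.sub_mem (P.smul_mem _ hw) hw₀) (P.smul_mem _ (P.smul_mem _
        (P.add_mem (P.smul_mem _ hu1P) (P.smul_mem _ hw₁))))
    simpa using (dvd_add (hv this) (dvd_mul_right (p : ℤ_[p]) b))

end Cyclic

/-! ### The structure of strongly hereditarily self-similar solvable lattices -/

section Structure

variable {L : Type*} [LieRing L] [LieAlgebra ℤ_[p] L]

/-- A non-zero `[x, y]` would span with `x` and `y` a Heisenberg lattice. -/
theorem lie_eq_zero_of_heisenberg [Module.IsTorsionFree ℤ_[p] L]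
    (hself : ∀ M : LieSubalgebra ℤ_[p] L, M ≠ ⊥ → IsSelfSimilar p M 1) {x y : L}
    (hx : ⁅x, ⁅x, y⁆⁆ = 0) (hy : ⁅y, ⁅x, y⁆⁆ = 0) : ⁅x, y⁆ = 0 := by
  by_contra hz
  have hyx : ⁅y, x⁆ = -⁅x, y⁆ := (lie_skew y x).symm
  have hzx : ⁅⁅x, y⁆, x⁆ = 0 := by rw [← lie_skew, hx, neg_zero]
  have hzy : ⁅⁅x, y⁆, y⁆ = 0 := by rw [← lie_skew, hy, neg_zero]
  let H : LieSubalgebra ℤ_[p] L :=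
    { Submodule.span ℤ_[p] {x, y, ⁅x, y⁆} with
      lie_mem' := by
        intro h₁ h₂ h₁m h₂m
        obtain ⟨a, b, c, rfl⟩ := Submodule.mem_span_triple.1 h₁m
        obtain ⟨a', b', c', rfl⟩ := Submodule.mem_span_triple.1 h₂m
        refine Submodule.mem_span_triple.2 ⟨0, 0, a * b' - b * a', ?_⟩
        simp only [add_lie, lie_add, smul_lie, lie_smul, hx, hy, hyx, hzx, hzy, lie_self]
        module }
  have hxH : x ∈ H := Submodule.subset_span (by simp)
  have hyH : y ∈ H := Submodule.subset_span (by simp)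
  have hzH : ⁅x, y⁆ ∈ H := Submodule.subset_span (by simp)
  have : Module.IsTorsionFree ℤ_[p] H := inferInstanceAs (Module.IsTorsionFree ℤ_[p] H.toSubmodule)
  refine not_isSelfSimilar_of_heisenberg (p := p) (H := H) (x := ⟨x, hxH⟩) (y := ⟨y, hyH⟩)
    (z := ⟨_, hzH⟩) rfl (Subtype.ext hx) (Subtype.ext hy) (fun h => hz (congrArg Subtype.val h))
    ?_ (hself H fun h => hz (by rw [h] at hzH; exact hzH))
  rintro ⟨h, hh⟩
  obtain ⟨a, b, c, rfl⟩ := Submodule.mem_span_triple.1 hh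
  exact ⟨a, b, c, rfl⟩

/-- Every element of an abelian ideal is an eigenvector of every `ad x`: otherwise it generates
together with `x` a Heisenberg algebra, if `ad x` acts nilpotently on it, or else an algebra that
has a sublattice as in `not_isSelfSimilar_of_cyclic`. -/
theorem exists_lie_eq_smul [Module.IsTorsionFree ℤ_[p] L] [Module.Finite ℤ_[p] L]
    (hself : ∀ M : LieSubalgebra ℤ_[p] L, M ≠ ⊥ → IsSelfSimilar p M 1) {A : LieIdeal ℤ_[p] L}
    (hA : ∀ a ∈ A, ∀ b ∈ A, ⁅a, b⁆ = 0) (x : L) {v : L} (hv : v ∈ A) :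
    ∃ r : ℤ_[p], ⁅x, v⁆ = r • v := by
  have hp0 : (p : ℤ_[p]) ≠ 0 := by exact_mod_cast (Fact.out : p.Prime).ne_zero
  set D := LieAlgebra.ad ℤ_[p] L x with hD
  have hDs (n : ℕ) : ⁅x, (D ^ n) v⁆ = (D ^ (n + 1)) v := by
    rw [pow_succ', Module.End.mul_apply, hD, LieAlgebra.ad_apply]
  have hDA (n : ℕ) : (D ^ n) v ∈ A := by
    induction n with
    | zero => simpa using hv
    | succ n ih => rw [← hDs]; exact A.lie_mem ih
  by_cases hnil : ∃ n, (D ^ n) v = 0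
  · classical
    have hspec := Nat.find_spec hnil
    rcases hn : Nat.find hnil with _ | _ | n
    · rw [hn, pow_zero, Module.End.one_apply] at hspec
      exact ⟨0, by rw [hspec, lie_zero, smul_zero]⟩
    · rw [hn, zero_add, pow_one] at hspec
      exact ⟨0, by rw [zero_smul]; exact hspec⟩
    · rw [hn] at hspec
      refine absurd ?_ (Nat.find_min hnil (m := n + 1) (by omega))
      rw [← hDs]
      refine lie_eq_zero_of_heisenberg hself ?_ ?_
      · rw [hDs, hDs, hspec]
      · rw [hDs]; exact hA _ (hDA n) _ (hDA _)
  push Not at hnil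
  by_contra! hne
  let w (i : ℕ) : L := (p : ℤ_[p]) • (D ^ i) v
  have hwA (i : ℕ) : w i ∈ A := A.smul_mem _ (hDA i)
  have hXv : ⁅(p : ℤ_[p]) • x, v⁆ = w 1 := by
    rw [smul_lie]; simp only [w, pow_one]; rfl
  have hXw (i : ℕ) : ⁅(p : ℤ_[p]) • x, w i⁆ = (p : ℤ_[p]) • w (i + 1) := by
    simp only [w, smul_lie, lie_smul, hDs]
  let Q : Submodule ℤ_[p] L := Submodule.span ℤ_[p] {v} ⊔ Submodule.span ℤ_[p] (Set.range w)
  have hQA : Q ≤ A.toSubmodule := by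
    refine sup_le (by simpa using hv) (Submodule.span_le.2 ?_)
    rintro _ ⟨i, rfl⟩
    exact hwA i
  have hXQ {l : L} (hl : l ∈ Q) : ⁅(p : ℤ_[p]) • x, l⁆ ∈ Q := by
    have : Q ≤ Q.comap (LieAlgebra.ad ℤ_[p] L ((p : ℤ_[p]) • x)) := by
      refine sup_le ?_ (Submodule.span_le.2 ?_)
      · rw [Submodule.span_singleton_le_iff_mem]
        change ⁅(p : ℤ_[p]) • x, v⁆ ∈ Q
        rw [hXv]
        exact Submodule.mem_sup_right (Submodule.subset_span ⟨1, rfl⟩)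
      · rintro _ ⟨i, rfl⟩
        change ⁅(p : ℤ_[p]) • x, w i⁆ ∈ Q
        rw [hXw]
        exact Q.smul_mem _ (Submodule.mem_sup_right (Submodule.subset_span ⟨i + 1, rfl⟩))
    exact this hl
  let H : LieSubalgebra ℤ_[p] L :=
    { Submodule.span ℤ_[p] {(p : ℤ_[p]) • x} ⊔ Q with
      lie_mem' := by
        intro h₁ h₂ h₁m h₂m
        obtain ⟨_, hX₁, l₁, hl₁, rfl⟩ := Submodule.mem_sup.1 h₁m
        obtain ⟨_, hX₂, l₂, hl₂, rfl⟩ := Submodule.mem_sup.1 h₂m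
        obtain ⟨a, rfl⟩ := Submodule.mem_span_singleton.1 hX₁
        obtain ⟨b, rfl⟩ := Submodule.mem_span_singleton.1 hX₂
        refine Submodule.mem_sup_right ?_
        have : ⁅a • (p : ℤ_[p]) • x + l₁, b • (p : ℤ_[p]) • x + l₂⁆
            = a • ⁅(p : ℤ_[p]) • x, l₂⁆ - b • ⁅(p : ℤ_[p]) • x, l₁⁆ := by
          rw [add_lie, lie_add, lie_add, hA _ (hQA hl₁) _ (hQA hl₂), smul_lie a, lie_smul b,
            lie_self, ← lie_skew l₁, smul_lie a, smul_lie b]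
          module
        rw [this]
        exact Q.sub_mem (Q.smul_mem _ (hXQ hl₂)) (Q.smul_mem _ (hXQ hl₁)) }
  have hXH : (p : ℤ_[p]) • x ∈ H :=
    Submodule.mem_sup_left (Submodule.mem_span_singleton_self _)
  have hQH {l : L} (hl : l ∈ Q) : l ∈ H := Submodule.mem_sup_right hl
  have hvH : v ∈ H := hQH (Submodule.mem_sup_left (Submodule.mem_span_singleton_self _))
  have hwH (i : ℕ) : w i ∈ H := hQH (Submodule.mem_sup_right (Submodule.subset_span ⟨i, rfl⟩))
  let u (i : ℕ) : H := ⟨w i, hwH i⟩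
  let Λ : Submodule ℤ_[p] H := Submodule.span ℤ_[p] {⟨v, hvH⟩} ⊔ Submodule.span ℤ_[p] (Set.range u)
  have hΛ : Λ.map H.toSubmodule.subtype = Q := by
    rw [Submodule.map_sup, Submodule.map_span, Submodule.map_span, Set.image_singleton,
      ← Set.range_comp]
    rfl
  have : Module.IsTorsionFree ℤ_[p] H := inferInstanceAs (Module.IsTorsionFree ℤ_[p] H.toSubmodule)
  have : Module.Finite ℤ_[p] H := inferInstanceAs (Module.Finite ℤ_[p] H.toSubmodule)
  refine not_isSelfSimilar_of_cyclic (p := p) (H := H) (X := ⟨(p : ℤ_[p]) • x, hXH⟩)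
    (v := ⟨v, hvH⟩) (u := u) (Λ := Λ) rfl rfl (Subtype.ext ?_) (Subtype.ext hXv)
    (fun i => Subtype.ext (hXw i)) ?_ ?_ ?_ ?_ (hself H ?_)
  · simp [u, w]
  · intro a ha b hb
    exact Subtype.ext (hA _ (hQA (hΛ ▸ Submodule.mem_map_of_mem ha)) _
      (hQA (hΛ ▸ Submodule.mem_map_of_mem hb)))
  · rintro ⟨h, hh⟩
    obtain ⟨_, hX, l, hl, rfl⟩ := Submodule.mem_sup.1 hh
    obtain ⟨a, rfl⟩ := Submodule.mem_span_singleton.1 hX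
    rw [← hΛ] at hl
    obtain ⟨l, hl, rfl⟩ := hl
    exact ⟨a, l, hl, rfl⟩
  · intro i h
    exact smul_ne_zero hp0 (hnil i) (congrArg Subtype.val h)
  · intro r h
    have h1 : w 1 = r • w 0 := congrArg Subtype.val h
    refine hne r (smul_right_injective L hp0 ?_)
    simp only [w, pow_one, pow_zero, Module.End.one_apply] at h1
    rw [smul_comm] at h1
    exact h1
  · intro h
    have hv0 : v ∈ H := hvH
    rw [h] at hv0
    exact hnil 0 hv0

/-- A maximal abelian ideal of a solvable Lie lattice without Heisenberg subalgebras is its own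
centralizer. If not, the last term of the derived series whose intersection with the centralizer
is not contained in the ideal yields a larger ideal of nilpotency class at most two, which is
abelian because it contains no Heisenberg algebra. -/
theorem exists_selfCentralizing_abelian_ideal [Module.Finite ℤ_[p] L]
    (hsolv : LieAlgebra.IsSolvable L)
    (hheis : ∀ x y : L, ⁅x, ⁅x, y⁆⁆ = 0 → ⁅y, ⁅x, y⁆⁆ = 0 → ⁅x, y⁆ = 0) :
    ∃ A : LieIdeal ℤ_[p] L, (∀ a ∈ A, ∀ b ∈ A, ⁅a, b⁆ = 0) ∧
      ∀ x, (∀ a ∈ A, ⁅x, a⁆ = 0) → x ∈ A := by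
  obtain ⟨A, hA, hmax⟩ := (wellFounded_gt (α := LieIdeal ℤ_[p] L)).has_min
    {A | ∀ a ∈ A, ∀ b ∈ A, ⁅a, b⁆ = 0} ⟨⊥, by
      intro a ha b _
      rw [LieSubmodule.mem_bot] at ha
      rw [ha, zero_lie]⟩
  refine ⟨A, hA, ?_⟩
  let C : LieIdeal ℤ_[p] L := LieModule.ker ℤ_[p] L A
  have hC {c : L} : c ∈ C ↔ ∀ a ∈ A, ⁅c, a⁆ = 0 := by
    rw [LieModule.mem_ker]
    exact ⟨fun h a ha => congrArg Subtype.val (h ⟨a, ha⟩), fun h a => Subtype.ext (h a a.2)⟩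
  suffices h : C ≤ A from fun x hx => h (hC.2 hx)
  by_contra hCA
  have hex : ∃ k, C ⊓ LieAlgebra.derivedSeries ℤ_[p] L k ≤ A := by
    obtain ⟨k, hk⟩ := (LieAlgebra.isSolvable_iff ℤ_[p] L).1 hsolv
    exact ⟨k, by rw [hk, inf_bot_eq]; exact bot_le⟩
  classical
  have hspec := Nat.find_spec hex
  rcases hn : Nat.find hex with _ | k
  · rw [hn] at hspec
    exact hCA (by simpa using hspec)
  rw [hn] at hspec
  have hk := Nat.find_min hex (m := k) (by omega)
  refine hmax (A ⊔ C ⊓ LieAlgebra.derivedSeries ℤ_[p] L k) ?_ (left_lt_sup.2 hk)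
  intro b hb b' hb'
  obtain ⟨a, ha, c, hc, rfl⟩ := LieSubmodule.mem_sup _ _ _ |>.1 hb
  obtain ⟨a', ha', c', hc', rfl⟩ := LieSubmodule.mem_sup _ _ _ |>.1 hb'
  rw [LieSubmodule.mem_inf] at hc hc'
  have hcc : ⁅c, c'⁆ ∈ A := by
    refine hspec (LieSubmodule.mem_inf _ _ _ |>.2 ⟨C.lie_mem hc'.1, ?_⟩)
    rw [LieAlgebra.derivedSeries_def, LieAlgebra.derivedSeriesOfIdeal_succ]
    exact LieSubmodule.lie_mem_lie hc.2 hc'.2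
  rw [add_lie, lie_add, lie_add, hA a ha a' ha', hC.1 hc.1 a' ha', ← lie_skew, hC.1 hc'.1 a ha,
    hheis c c' (hC.1 hc.1 _ hcc) (hC.1 hc'.1 _ hcc)]
  simp

/-- Here `f x` is the scalar by which `ad x` acts on a self-centralizing abelian ideal, which is
therefore the kernel of `f`. -/
theorem exists_linearMap_forall_lie_eq [Module.IsTorsionFree ℤ_[p] L] [Module.Finite ℤ_[p] L]
    [Nontrivial L]
    (hsolv : LieAlgebra.IsSolvable L)
    (hself : ∀ M : LieSubalgebra ℤ_[p] L, M ≠ ⊥ → IsSelfSimilar p M 1) :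
    ∃ f : L →ₗ[ℤ_[p]] ℤ_[p], ∀ x y : L, ⁅x, y⁆ = f x • y - f y • x := by
  obtain ⟨A, hA, hAC⟩ := exists_selfCentralizing_abelian_ideal (p := p) hsolv
    fun x y => lie_eq_zero_of_heisenberg hself
  have hscal (x : L) : ∃ r : ℤ_[p], ∀ a ∈ A, ⁅x, a⁆ = r • a := by
    obtain ⟨r, hr⟩ := LinearMap.exists_eq_smul_id_of_forall_notLinearIndependent
      (f := (LieAlgebra.ad ℤ_[p] L x).restrict (p := A.toSubmodule) (q := A.toSubmodule)
        fun a ha => A.lie_mem ha) (by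
        rintro ⟨v, hv⟩ hli
        obtain ⟨r, hr⟩ := exists_lie_eq_smul hself hA x hv
        have h := LinearIndependent.pair_iff.1 hli r (-1) (Subtype.ext (by
          change r • v + (-1 : ℤ_[p]) • ⁅x, v⁆ = 0
          rw [hr]
          module))
        exact one_ne_zero (neg_eq_zero.1 h.2))
    exact ⟨r, fun a ha => congrArg Subtype.val (LinearMap.congr_fun hr ⟨a, ha⟩)⟩
  choose f hf using hscal
  obtain ⟨v, hvA, hv⟩ : ∃ v ∈ A, v ≠ 0 := by
    by_contra! h
    obtain ⟨y, hy⟩ := exists_ne (0 : L)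
    exact hy (h y (hAC y fun a ha => by rw [h a ha, lie_zero]))
  have hf_unique {x : L} {r : ℤ_[p]} (h : ⁅x, v⁆ = r • v) : f x = r :=
    smul_left_injective ℤ_[p] hv ((hf x v hvA).symm.trans h)
  let F : L →ₗ[ℤ_[p]] ℤ_[p] :=
    { toFun := f
      map_add' := fun x y => hf_unique (by rw [add_lie, hf x v hvA, hf y v hvA, add_smul])
      map_smul' := fun t x => hf_unique (by rw [smul_lie, hf x v hvA, smul_smul]; rfl) }
  have hF (x : L) {a : L} (ha : a ∈ A) : ⁅x, a⁆ = F x • a := hf x a ha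
  have hker {x : L} (hx : F x = 0) : x ∈ A := hAC x fun a ha => by rw [hF x ha, hx, zero_smul]
  refine ⟨F, fun x y => ?_⟩
  by_cases hx : F x = 0
  · rw [← lie_skew, hF y (hker hx), hx, zero_smul, zero_sub]
  · -- `f x • y - f y • x` is in the kernel of `f`, so `ad x` multiplies it by `f x`.
    have h := hF x (hker (x := F x • y - F y • x) (by simp [mul_comm]))
    rw [lie_sub, lie_smul, lie_smul, lie_self, smul_zero, sub_zero] at h
    exact smul_right_injective L hx h

end Structure

/-! ### Comparison with the standard lattices -/

theorem pow_dvd_pPow_iff {n : ℕ} {s : ℕ∞} : (p : ℤ_[p]) ^ n ∣ pPow p s ↔ (n : ℕ∞) ≤ s := by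
  induction s using ENat.recTopCoe with
  | top => simp [pPow_top]
  | coe m =>
    rw [pPow_coe, Nat.cast_le]
    exact pow_dvd_pow_iff PadicInt.prime_p.ne_zero PadicInt.prime_p.not_isUnit

/-- Every linear form on a Lie lattice is a power of `p` (possibly `p ^ ∞ = 0`) times a form that
takes the value `1`. -/
theorem exists_eq_pPow_mul {M : Type*} [AddCommGroup M] [Module ℤ_[p] M] [Module.Free ℤ_[p] M]
    [Nontrivial M] (f : M →ₗ[ℤ_[p]] ℤ_[p]) :
    ∃ (s : ℕ∞) (g : M →ₗ[ℤ_[p]] ℤ_[p]), (∃ x, g x = 1) ∧ ∀ x, f x = pPow p s * g x := by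
  by_cases hf : f = 0
  · let b := Module.Free.chooseBasis ℤ_[p] M
    obtain ⟨i⟩ := b.index_nonempty
    exact ⟨⊤, b.coord i, ⟨b i, by simp⟩, fun x => by simp [hf, pPow_top]⟩
  · obtain ⟨n, hn⟩ := PadicInt.ideal_eq_span_pow_p (s := LinearMap.range f)
      (by rwa [Ne, LinearMap.range_eq_bot])
    have hpn : (p : ℤ_[p]) ^ n ≠ 0 := pow_ne_zero n PadicInt.prime_p.ne_zero
    have hdvd (x : M) : ∃ r, f x = (p : ℤ_[p]) ^ n * r :=
      Ideal.mem_span_singleton.1 (hn ▸ LinearMap.mem_range_self f x)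
    choose g hg using hdvd
    refine ⟨n, { toFun := g, map_add' := fun x y => ?_, map_smul' := fun t x => ?_ }, ?_, hg⟩
    · refine mul_left_cancel₀ hpn ?_
      rw [mul_add, ← hg, ← hg, ← hg, map_add]
    · refine mul_left_cancel₀ hpn ?_
      rw [RingHom.id_apply, smul_eq_mul, mul_left_comm, ← hg, ← hg, map_smul, smul_eq_mul]
    · obtain ⟨x, hx⟩ : (p : ℤ_[p]) ^ n ∈ LinearMap.range f :=
        hn ▸ Ideal.mem_span_singleton_self _
      exact ⟨x, mul_left_cancel₀ hpn ((hg x).symm.trans (hx.trans (mul_one _).symm))⟩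

/-- A Lie lattice with bracket `[x, y] = a (g x • y - g y • x)` is `L^d(a)`: complete a vector on
which `g` takes the value `1` by a basis of the kernel of `g`. -/
theorem nonempty_lieEquiv_std {L : Type*} [LieRing L] [LieAlgebra ℤ_[p] L] [Module.Free ℤ_[p] L]
    [Module.Finite ℤ_[p] L] {d : ℕ} [d.AtLeastTwo] (hd : Module.finrank ℤ_[p] L = d)
    {a : ℤ_[p]} {g : L →ₗ[ℤ_[p]] ℤ_[p]} {x₀ : L} (hx₀ : g x₀ = 1)
    (h : ∀ x y : L, ⁅x, y⁆ = a • (g x • y - g y • x)) :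
    Nonempty (L ≃ₗ⁅ℤ_[p]⁆ Std p d a) := by
  obtain ⟨m, ⟨k⟩⟩ : ∃ m, Nonempty (Module.Basis (Fin m) ℤ_[p] (LinearMap.ker g)) :=
    ⟨_, ⟨Module.finBasis ℤ_[p] (LinearMap.ker g)⟩⟩
  let b := Module.Basis.mkFinCons x₀ k
    (fun c y hy hcy => by simpa [hx₀, LinearMap.mem_ker.1 hy] using congrArg g hcy)
    (fun z => ⟨-g z, by simp [hx₀]⟩)
  have hb : (b : Fin (m + 1) → L) = Fin.cons x₀ ((↑) ∘ k) := Module.Basis.coe_mkFinCons x₀ _ _ _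
  obtain rfl : d = m + 1 := by rw [← hd, Module.finrank_eq_card_basis b, Fintype.card_fin]
  let e : L ≃ₗ[ℤ_[p]] Std p (m + 1) a := b.equiv (Std.basis p (m + 1) a) (Equiv.refl _)
  have he (x : L) : Std.coord (e x) = g x := by
    have : Std.coord ∘ₗ (e : L →ₗ[ℤ_[p]] Std p (m + 1) a) = g := by
      refine b.ext fun i => ?_
      rw [LinearMap.comp_apply, LinearEquiv.coe_coe, Module.Basis.equiv_apply, Equiv.refl_apply, hb]
      refine Fin.cases ?_ (fun i => ?_) i
      · rw [Fin.cons_zero, hx₀]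
        exact Std.coord_basis_zero
      · rw [Fin.cons_succ, Std.coord_basis (Fin.succ_ne_zero i)]
        exact (LinearMap.mem_ker.1 (k i).2).symm
    exact LinearMap.congr_fun this x
  exact ⟨{ e with
    map_lie' := fun {x y} => by
      change e ⁅x, y⁆ = ⁅e x, e y⁆
      rw [h, Std.lie_def, he, he, map_smul, map_sub, map_smul, map_smul] }⟩

/-- The divisors of all brackets of `L^d(a)` are the divisors of `a`; this makes `a` an isomorphism
invariant up to units. -/
theorem dvd_of_lieEquiv_std {d : ℕ} [hd : d.AtLeastTwo] {a b c : ℤ_[p]}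
    (e : Std p d a ≃ₗ⁅ℤ_[p]⁆ Std p d b) (hc : c ∣ a) : c ∣ b := by
  obtain ⟨r, rfl⟩ := hc
  have h2 := hd.prop
  let i : Fin d := ⟨1, h2⟩
  have hi : i ≠ 0 := fun h => by simpa [i] using congrArg Fin.val h
  obtain ⟨x, hx⟩ := e.surjective (Std.basis p d b 0)
  obtain ⟨y, hy⟩ := e.surjective (Std.basis p d b i)
  have h := Std.lie_basis_zero (p := p) (a := b) hi
  rw [← hx, ← hy, ← LieHom.map_lie, Std.lie_def, mul_smul, map_smul, hy] at h
  have h' := congrArg (fun z => (Std.basis p d b).repr z i) h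
  simp only [map_smul, Finsupp.smul_apply, Module.Basis.repr_self, Finsupp.single_eq_same,
    smul_eq_mul, mul_one] at h'
  exact ⟨_, h'.symm⟩

end ZpLieLattice

theorem mainTheorem6 (p : ℕ) [Fact p.Prime] (hp : 3 ≤ p) (d : ℕ) [d.AtLeastTwo]
    (L : Type*) [LieRing L] [LieAlgebra ℤ_[p] L]
    [Module.Free ℤ_[p] L] [Module.Finite ℤ_[p] L] (hd : Module.finrank ℤ_[p] L = d)
    (hsolv : LieAlgebra.IsSolvable L)
    (hself : ZpLieLattice.IsStronglyHereditarilySelfSimilar p L 1) :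
    ∃! s : ℕ∞, Nonempty (L ≃ₗ⁅ℤ_[p]⁆ ZpLieLattice.Std p d (ZpLieLattice.pPow p s)) := by
  have hd2 : 2 ≤ d := Nat.AtLeastTwo.prop
  have : Nontrivial L := Module.nontrivial_of_finrank_pos (R := ℤ_[p]) (by omega)
  obtain ⟨f, hf⟩ := ZpLieLattice.exists_linearMap_forall_lie_eq hsolv hself.2
  obtain ⟨s, g, ⟨x₀, hx₀⟩, hg⟩ := ZpLieLattice.exists_eq_pPow_mul f
  obtain ⟨e⟩ := ZpLieLattice.nonempty_lieEquiv_std (a := ZpLieLattice.pPow p s) hd hx₀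
    fun x y => by rw [hf, hg, hg, smul_sub, smul_smul, smul_smul]
  refine ⟨s, ⟨e⟩, fun t ⟨e'⟩ => ENat.eq_of_forall_natCast_le_iff fun n => ?_⟩
  rw [← ZpLieLattice.pow_dvd_pPow_iff (p := p), ← ZpLieLattice.pow_dvd_pPow_iff (p := p)]
  exact ⟨ZpLieLattice.dvd_of_lieEquiv_std (e'.symm.trans e),
    ZpLieLattice.dvd_of_lieEquiv_std (e.symm.trans e')⟩
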